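/- Let $M$ be a smooth manifold, $g$ a semi-Riemannian metric on $M$ with Levi-Civita connection $\overline\nabla$, and $\sigma$ an almost paraquaternionic structure on $M$, that is, a rank-3 subbundle of $\mathrm{End}(TM)$ which near every point has a smooth local basis $J_1,J_2,J_3$ (a canonical local basis) with $$J_\alpha^2=-\epsilon_\alpha \mathrm{Id},\qquad J_\alpha J_{\alpha+1}=-J_{\alpha+1}J_\alpha=\epsilon_{\alpha+2}J_{\alpha+2},$$ where $\epsilon_1=1$, $\epsilon_2=\epsilon_3=-1$ and indices are taken modulo $3$. Suppose that $(M,\sigma,g)$ is a paraquaternionic Kähler manifold, i.e. $g(J_\alpha X,J_\alpha Y)=\epsilon_\alpha g(X,Y)$ for every canonical local basis, and $\sigma$ is parallel with respect to $\overline\nabla$. Let $N$ be an immersed submanifold of $M$ on which the induced metric is non-degenerate, let $B$ be its second fundamental form, i.e. $B(X,Y)$ is the component of $\overline\nabla_XY$ normal to $N$, and suppose that $N$ is a paraquaternionic CR-submanifold of $M$ with paraquaternionic distribution $\mathcal D$: $\mathcal D\subseteq TN$ is a smooth distribution on which $g$ is non-degenerate, and for every canonical local basis $J_1,J_2,J_3$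 of $\sigma$ on an open set $U\subseteq M$, every $x\in N\cap U$ and every $\alpha\in\{1,2,3\}$, $$J_\alpha\mathcal D_x=\mathcal D_x\qquad\text{and}\qquad J_\alpha\mathcal D_x^\perp\subseteq T_x^\perp N,$$ where $\mathcal D^\perp$ is the orthogonal complement of $\mathcal D$ in $TN$ and $T_x^\perp N$ is the normal space of $N$ at $x$. Then $\mathcal D$ is integrable (i.e. $[X,Y]\in\Gamma(\mathcal D)$ for all $X,Y\in\Gamma(\mathcal D)$) if and only if $N$ is $\mathcal D$-geodesic, i.e. $B(X,Y)=0$ for all $X,Y\in\Gamma(\mathcal D)$. -/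

import Mathlib

open scoped Manifold ContDiff
open Bundle

noncomputable section

namespace ParaquaternionicGeometry

section Ambient

variable {E : Type*} [NormedAddCommGroup E] [NormedSpace ℝ E]
  {M : Type*} [TopologicalSpace M] [ChartedSpace E M] [IsManifold 𝓘(ℝ, E) ∞ M]

/-- The (not necessarily continuous) vector field `X` is smooth on the set `U`. -/
def IsSmoothFieldOn (X : ∀ x : M, TangentSpace 𝓘(ℝ, E) x) (U : Set M) : Prop :=
  ContMDiffOn 𝓘(ℝ, E) 𝓘(ℝ, E).tangent ∞ (fun x ↦ (⟨x, X x⟩ : TangentBundle 𝓘(ℝ, E) M)) U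

/-- The field of endomorphisms `A` of the tangent spaces is smooth on the set `U`. -/
def IsSmoothEndOn (A : ∀ x : M, TangentSpace 𝓘(ℝ, E) x →L[ℝ] TangentSpace 𝓘(ℝ, E) x)
    (U : Set M) : Prop :=
  ContMDiffOn 𝓘(ℝ, E) (𝓘(ℝ, E).prod 𝓘(ℝ, E →L[ℝ] E)) ∞
    (fun x ↦ TotalSpace.mk' (E →L[ℝ] E)
      (E := fun x : M ↦ TangentSpace 𝓘(ℝ, E) x →L[ℝ] TangentSpace 𝓘(ℝ, E) x) x (A x)) U

variable (E M) in
/-- A semi-Riemannian metric: a smooth field of symmetric non-degenerate bilinear forms on the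
tangent spaces. -/
structure SemiRiemannianMetric where
  /-- the bilinear form `g_x` -/
  val (x : M) : TangentSpace 𝓘(ℝ, E) x →L[ℝ] TangentSpace 𝓘(ℝ, E) x →L[ℝ] ℝ
  symm (x : M) (v w : TangentSpace 𝓘(ℝ, E) x) : val x v w = val x w v
  nondegenerate (x : M) (v : TangentSpace 𝓘(ℝ, E) x) : (∀ w, val x v w = 0) → v = 0
  contMDiff :
    ContMDiff 𝓘(ℝ, E) (𝓘(ℝ, E).prod 𝓘(ℝ, E →L[ℝ] E →L[ℝ] ℝ)) ∞
      (fun x ↦ TotalSpace.mk' (E →L[ℝ] E →L[ℝ] ℝ)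
        (E := fun x : M ↦ TangentSpace 𝓘(ℝ, E) x →L[ℝ] TangentSpace 𝓘(ℝ, E) x →L[ℝ] ℝ)
        x (val x))

/-! ### The Levi-Civita connection

All formulas at a point `x` are written in the trivialization of `TM` given by the preferred chart
at `x`; over `x` itself this trivialization is the identity of `TangentSpace 𝓘(ℝ, E) x = E`. -/

/-- The metric near `x`, as a function into the bilinear forms on `E`, read in the chart
at `x`. -/
def SemiRiemannianMetric.inChart (g : SemiRiemannianMetric E M) (x y : M) : E →L[ℝ] E →L[ℝ] ℝ :=
  let S : E →L[ℝ] TangentSpace 𝓘(ℝ, E) y :=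
    (trivializationAt E (TangentSpace 𝓘(ℝ, E)) x).symmL ℝ y
  ContinuousLinearMap.precomp ℝ S ∘L g.val y ∘L S

/-- The Christoffel symbols `Γ(v, ·)` at `x` of the Levi-Civita connection, in the chart at `x`:
`2 g(Γ(v, w), z) = (∂_v g)(w, z) + (∂_w g)(v, z) - (∂_z g)(v, w)`. -/
def SemiRiemannianMetric.christoffel (g : SemiRiemannianMetric E M) (x : M)
    (v : TangentSpace 𝓘(ℝ, E) x) : TangentSpace 𝓘(ℝ, E) x →L[ℝ] TangentSpace 𝓘(ℝ, E) x :=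
  let dG : E →L[ℝ] E →L[ℝ] E →L[ℝ] ℝ :=
    mfderiv 𝓘(ℝ, E) 𝓘(ℝ, E →L[ℝ] E →L[ℝ] ℝ) (g.inChart x) x
  let lower : E →L[ℝ] E →L[ℝ] ℝ := (1 / 2 : ℝ) • (dG v + dG.flip v - (dG.flip v).flip)
  (g.val x).inverse ∘L lower

/-- The covariant derivative `(∇_v A)(x)`, for the connection on `End(TM)` induced by the
Levi-Civita connection, of a field `A` of endomorphisms: in the chart at `x` it is
`∂_v A + Γ(v, A ·) - A Γ(v, ·)`, so that `(∇_v A) Y = ∇_v (A Y) - A (∇_v Y)`. -/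
def SemiRiemannianMetric.covDerivEnd (g : SemiRiemannianMetric E M)
    (A : ∀ x : M, TangentSpace 𝓘(ℝ, E) x →L[ℝ] TangentSpace 𝓘(ℝ, E) x) (x : M)
    (v : TangentSpace 𝓘(ℝ, E) x) : TangentSpace 𝓘(ℝ, E) x →L[ℝ] TangentSpace 𝓘(ℝ, E) x :=
  let dA : TangentSpace 𝓘(ℝ, E) x →L[ℝ] TangentSpace 𝓘(ℝ, E) x →L[ℝ] TangentSpace 𝓘(ℝ, E) x :=
    mfderiv 𝓘(ℝ, E) 𝓘(ℝ, E →L[ℝ] E)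
      (fun y ↦ ContinuousLinearMap.inCoordinates E (TangentSpace 𝓘(ℝ, E)) E
        (TangentSpace 𝓘(ℝ, E)) x y x y (A y)) x
  dA v + g.christoffel x v ∘L A x - A x ∘L g.christoffel x v

/-! ### Almost paraquaternionic structures -/

/-- The signs `ε₁ = 1`, `ε₂ = ε₃ = -1`; the indices `1, 2, 3` modulo `3` are `0, 1, 2 : Fin 3`. -/
def epsilon : Fin 3 → ℝ := ![1, -1, -1]

/-- `J₁, J₂, J₃` is a canonical local basis over the open set `U` of the family `σ` of subspaces
of the spaces `End(T_x M)`. -/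
structure IsCanonicalLocalBasis
    (σ : ∀ x : M, Submodule ℝ (TangentSpace 𝓘(ℝ, E) x →L[ℝ] TangentSpace 𝓘(ℝ, E) x))
    (U : Set M)
    (J : Fin 3 → ∀ x : M, TangentSpace 𝓘(ℝ, E) x →L[ℝ] TangentSpace 𝓘(ℝ, E) x) : Prop where
  isOpen : IsOpen U
  smooth : ∀ a, IsSmoothEndOn (J a) U
  linearIndependent : ∀ x ∈ U, LinearIndependent ℝ (fun a ↦ J a x)
  span_eq : ∀ x ∈ U, Submodule.span ℝ (Set.range fun a ↦ J a x) = σ x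
  sq : ∀ x ∈ U, ∀ a, J a x ∘L J a x = -epsilon a • ContinuousLinearMap.id ℝ _
  mul : ∀ x ∈ U, ∀ a, J a x ∘L J (a + 1) x = epsilon (a + 2) • J (a + 2) x
  anticomm : ∀ x ∈ U, ∀ a, J a x ∘L J (a + 1) x = -(J (a + 1) x ∘L J a x)

variable (E M) in
/-- An almost paraquaternionic structure: a rank-3 subbundle `σ` of `End(TM)` which has a canonical
local basis near every point. -/
structure AlmostParaquaternionicStructure where
  /-- the fibre `σ_x` -/
  fiber (x : M) : Submodule ℝ (TangentSpace 𝓘(ℝ, E) x →L[ℝ] TangentSpace 𝓘(ℝ, E) x)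
  exists_basis (x : M) : ∃ U, x ∈ U ∧ ∃ J, IsCanonicalLocalBasis fiber U J

/-- The metric `g` is adapted to `σ`, i.e. `(M, σ, g)` is almost paraquaternionic hermitian. -/
def IsAdapted (g : SemiRiemannianMetric E M) (σ : AlmostParaquaternionicStructure E M) : Prop :=
  ∀ U J, IsCanonicalLocalBasis σ.fiber U J → ∀ x ∈ U, ∀ a v w,
    g.val x (J a x v) (J a x w) = epsilon a * g.val x v w

/-- The subbundle `σ` is parallel for the Levi-Civita connection of `g`: covariant derivatives of
smooth local sections of `σ` lie in `σ`. -/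
def IsParallel (g : SemiRiemannianMetric E M) (σ : AlmostParaquaternionicStructure E M) : Prop :=
  ∀ (U : Set M) (A : ∀ x : M, TangentSpace 𝓘(ℝ, E) x →L[ℝ] TangentSpace 𝓘(ℝ, E) x),
    IsOpen U → IsSmoothEndOn A U → (∀ x ∈ U, A x ∈ σ.fiber x) →
      ∀ x ∈ U, ∀ v, g.covDerivEnd A x v ∈ σ.fiber x

/-- `(M, σ, g)` is a paraquaternionic Kähler manifold. -/
structure IsParaquaternionicKahler (g : SemiRiemannianMetric E M)
    (σ : AlmostParaquaternionicStructure E M) : Prop where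
  adapted : IsAdapted g σ
  parallel : IsParallel g σ

end Ambient

/-! ### Distributions -/

section Distribution

variable {F : Type*} [NormedAddCommGroup F] [NormedSpace ℝ F]
  {N : Type*} [TopologicalSpace N] [ChartedSpace F N] [IsManifold 𝓘(ℝ, F) ∞ N]

/-- `D` is a smooth distribution, i.e. a smooth subbundle of `TN`: near every point it is spanned
by pointwise linearly independent smooth vector fields. -/
def IsSmoothDistribution (D : ∀ x : N, Submodule ℝ (TangentSpace 𝓘(ℝ, F) x)) : Prop :=
  ∀ x : N, ∃ U : Set N, IsOpen U ∧ x ∈ U ∧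
    ∃ (k : ℕ) (X : Fin k → ∀ y : N, TangentSpace 𝓘(ℝ, F) y),
      (∀ i, IsSmoothFieldOn (X i) U) ∧
      ∀ y ∈ U, LinearIndependent ℝ (fun i ↦ X i y) ∧
        Submodule.span ℝ (Set.range fun i ↦ X i y) = D y

/-- `X` is a smooth section of `D` over `U`. -/
def IsSectionOn (D : ∀ x : N, Submodule ℝ (TangentSpace 𝓘(ℝ, F) x))
    (X : ∀ x : N, TangentSpace 𝓘(ℝ, F) x) (U : Set N) : Prop :=
  IsSmoothFieldOn X U ∧ ∀ x ∈ U, X x ∈ D x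

/-- The distribution `D` is integrable: `[X, Y]` is a section of `D` whenever `X` and `Y` are
(over any open set). -/
def IsIntegrable (D : ∀ x : N, Submodule ℝ (TangentSpace 𝓘(ℝ, F) x)) : Prop :=
  ∀ (U : Set N) (X Y : ∀ x : N, TangentSpace 𝓘(ℝ, F) x), IsOpen U →
    IsSectionOn D X U → IsSectionOn D Y U →
      ∀ x ∈ U, VectorField.mlieBracket 𝓘(ℝ, F) X Y x ∈ D x

end Distribution

/-! ### Submanifolds -/

section Submanifold

variable {E : Type*} [NormedAddCommGroup E] [NormedSpace ℝ E]
  {M : Type*} [TopologicalSpace M] [ChartedSpace E M] [IsManifold 𝓘(ℝ, E) ∞ M]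
  {F : Type*} [NormedAddCommGroup F] [NormedSpace ℝ F]
  {N : Type*} [TopologicalSpace N] [ChartedSpace F N] [IsManifold 𝓘(ℝ, F) ∞ N]

/-- The covariant derivative at `p` in the direction `u ∈ T_p N`, for the Levi-Civita connection
of `g`, of a vector field `V` along the map `f : N → M`. In the chart at `f p` it is
`∂_u V + Γ(df u, V)`. -/
def SemiRiemannianMetric.covDerivAlong (g : SemiRiemannianMetric E M) (f : N → M)
    (V : ∀ q : N, TangentSpace 𝓘(ℝ, E) (f q)) (p : N) (u : TangentSpace 𝓘(ℝ, F) p) :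
    TangentSpace 𝓘(ℝ, E) (f p) :=
  let dV : TangentSpace 𝓘(ℝ, F) p →L[ℝ] TangentSpace 𝓘(ℝ, E) (f p) :=
    mfderiv 𝓘(ℝ, F) 𝓘(ℝ, E)
      (fun q ↦ (trivializationAt E (TangentSpace 𝓘(ℝ, E)) (f p) ⟨f q, V q⟩).2) p
  dV u + g.christoffel (f p) (mfderiv 𝓘(ℝ, F) 𝓘(ℝ, E) f p u) (V p)

/-- The bilinear form induced by `g` on `T_p N`. -/
def SemiRiemannianMetric.induced (g : SemiRiemannianMetric E M) (f : N → M) (p : N) :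
    TangentSpace 𝓘(ℝ, F) p →L[ℝ] TangentSpace 𝓘(ℝ, F) p →L[ℝ] ℝ :=
  ContinuousLinearMap.precomp ℝ (mfderiv 𝓘(ℝ, F) 𝓘(ℝ, E) f p) ∘L
    g.val (f p) ∘L mfderiv 𝓘(ℝ, F) 𝓘(ℝ, E) f p

variable (F) in
/-- `f : N → M` is an immersed submanifold which is non-degenerate for `g`. -/
structure IsNondegenerateSubmanifold (g : SemiRiemannianMetric E M) (f : N → M) : Prop where
  isImmersion : Manifold.IsImmersion 𝓘(ℝ, F) 𝓘(ℝ, E) ∞ f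
  nondegenerate (p : N) (u : TangentSpace 𝓘(ℝ, F) p) :
    (∀ v, g.induced (F := F) f p u v = 0) → u = 0

/-- The tangent part of `w ∈ T_{f p} M`, as an element of `T_p N`: the vector `u` with
`g(df u, df v) = g(w, df v)` for all `v`. -/
def SemiRiemannianMetric.tangentPart (g : SemiRiemannianMetric E M) (f : N → M) (p : N)
    (w : TangentSpace 𝓘(ℝ, E) (f p)) : TangentSpace 𝓘(ℝ, F) p :=
  (g.induced (F := F) f p).inverse (g.val (f p) w ∘L mfderiv 𝓘(ℝ, F) 𝓘(ℝ, E) f p)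

variable (F) in
/-- The normal part of `w ∈ T_{f p} M` in `T_{f p} M = T_p N ⊕ (T_p N)^⊥`. -/
def SemiRiemannianMetric.normalPart (g : SemiRiemannianMetric E M) (f : N → M) (p : N)
    (w : TangentSpace 𝓘(ℝ, E) (f p)) : TangentSpace 𝓘(ℝ, E) (f p) :=
  w - mfderiv 𝓘(ℝ, F) 𝓘(ℝ, E) f p (g.tangentPart (F := F) f p w)

/-- The second fundamental form `B(X, Y)` of the submanifold `f : N → M`: the normal part of the
ambient covariant derivative of `Y` along `X`. -/
def SemiRiemannianMetric.secondFundamentalForm (g : SemiRiemannianMetric E M) (f : N → M)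
    (X Y : ∀ q : N, TangentSpace 𝓘(ℝ, F) q) (p : N) : TangentSpace 𝓘(ℝ, E) (f p) :=
  g.normalPart F f p
    (g.covDerivAlong f (fun q ↦ mfderiv 𝓘(ℝ, F) 𝓘(ℝ, E) f q (Y q)) p (X p))

/-- `N` is `D`-geodesic: `B(X, Y) = 0` for all sections `X`, `Y` of `D` (over any open set). -/
def IsGeodesicFor (g : SemiRiemannianMetric E M) (f : N → M)
    (D : ∀ x : N, Submodule ℝ (TangentSpace 𝓘(ℝ, F) x)) : Prop :=
  ∀ (U : Set N) (X Y : ∀ x : N, TangentSpace 𝓘(ℝ, F) x), IsOpen U →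
    IsSectionOn D X U → IsSectionOn D Y U →
      ∀ x ∈ U, g.secondFundamentalForm f X Y x = 0

/-- The submanifold `f : N → M` of the almost paraquaternionic hermitian manifold `(M, σ, g)` is a
paraquaternionic CR-submanifold, with paraquaternionic distribution `D`. -/
structure IsParaquaternionicCRSubmanifold (g : SemiRiemannianMetric E M)
    (σ : AlmostParaquaternionicStructure E M) (f : N → M)
    (D : ∀ x : N, Submodule ℝ (TangentSpace 𝓘(ℝ, F) x)) : Prop where
  submanifold : IsNondegenerateSubmanifold F g f
  smooth : IsSmoothDistribution D
  nondegenerate : ∀ x, ∀ u ∈ D x, (∀ v ∈ D x, g.induced f x u v = 0) → u = 0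
  /-- `J_α D_x = D_x` -/
  invariant : ∀ U J, IsCanonicalLocalBasis σ.fiber U J → ∀ x, f x ∈ U → ∀ a : Fin 3,
    ((D x).map (mfderiv 𝓘(ℝ, F) 𝓘(ℝ, E) f x).toLinearMap).map (J a (f x)).toLinearMap =
      (D x).map (mfderiv 𝓘(ℝ, F) 𝓘(ℝ, E) f x).toLinearMap
  /-- `J_α` maps the orthogonal complement of `D_x` in `T_x N` into the normal space -/
  totallyReal : ∀ U J, IsCanonicalLocalBasis σ.fiber U J → ∀ x, f x ∈ U → ∀ a : Fin 3,
    ∀ u : TangentSpace 𝓘(ℝ, F) x, (∀ v ∈ D x, g.induced f x u v = 0) →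
      ∀ v : TangentSpace 𝓘(ℝ, F) x,
        g.val (f x) (J a (f x) (mfderiv 𝓘(ℝ, F) 𝓘(ℝ, E) f x u))
          (mfderiv 𝓘(ℝ, F) 𝓘(ℝ, E) f x v) = 0

end Submanifold

end ParaquaternionicGeometry

end
/-!
Let `A` be a local section of `σ`. As `σ` is parallel, `(∇ A) X` lies in `D` for every section `X`
of `D`, so the normal part of `∇_u (A X)` is that of `A (∇_u X)`.

If `D` is integrable, then `A [X, Y]` lies in `D`, and torsion-freeness gives
`B(X, A Y) = B(A X, Y)`. Hence
`B(J₀ X, Y) = B(X, J₀ Y) = B(X, J₁ J₂ Y) = B(J₁ X, J₂ Y) = B(J₂ J₁ X, Y) = -B(J₀ X, Y)`,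
and `B` vanishes on `D` because `J₀² = -1`.

Conversely, if `B` vanishes on `D`, then `J₀ ∇_X Y` is tangent to `N`, whereas `J₀ Dᗮ` is normal;
as `J₀` is an isometry, `∇_X Y` is orthogonal to `Dᗮ`, and so is `[X, Y] = ∇_X Y - ∇_Y X`.
-/

noncomputable section

namespace ParaquaternionicGeometry

section Calculus

variable {𝕜 : Type*} [NontriviallyNormedField 𝕜] {E : Type*} [NormedAddCommGroup E]
  [NormedSpace 𝕜 E] {H : Type*} [TopologicalSpace H] {I : ModelWithCorners 𝕜 E H}
  {M : Type*} [TopologicalSpace M] [ChartedSpace H M]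
  {V W : Type*} [NormedAddCommGroup V] [NormedSpace 𝕜 V] [NormedAddCommGroup W] [NormedSpace 𝕜 W]

lemma mvfderiv_congr {h h' : M → V} {p : M} (hh' : h =ᶠ[nhds p] h') :
    mvfderiv I h p = mvfderiv I h' p := by
  rw [mvfderiv, mvfderiv, hh'.mfderiv_eq, hh'.eq_of_nhds]

lemma mvfderiv_clm_apply {a : M → V →L[𝕜] W} {b : M → V} {p : M}
    (ha : MDifferentiableAt I 𝓘(𝕜, V →L[𝕜] W) a p) (hb : MDifferentiableAt I 𝓘(𝕜, V) b p)
    (u : TangentSpace I p) :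
    mvfderiv I (fun q ↦ a q (b q)) p u = mvfderiv I a p u (b p) + a p (mvfderiv I b p u) := by
  have h := ha.hasMFDerivAt.2.clm_apply hb.hasMFDerivAt.2
  have hab : HasMFDerivAt I 𝓘(𝕜, W) (fun q ↦ a q (b q)) p _ :=
    ⟨ha.continuousAt.clm_apply hb.continuousAt, h⟩
  refine (congrArg (fun L : E →L[𝕜] W ↦ L u) hab.mfderiv).trans ?_
  simp only [writtenInExtChartAt, Function.comp_apply, extChartAt_to_inv]
  exact add_comm _ _

lemma mvfderiv_apply_comm {b : M → V →L[𝕜] V →L[𝕜] W} (hb : ∀ q v w, b q v w = b q w v)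
    (p : M) (u : TangentSpace I p) (v w : V) : mvfderiv I b p u v w = mvfderiv I b p u w v := by
  by_cases h : MDifferentiableAt I 𝓘(𝕜, V →L[𝕜] V →L[𝕜] W) b p
  · have hderiv (v w : V) : mvfderiv I b p u v w = mvfderiv I (fun q ↦ b q v w) p u := by
      rw [mvfderiv_clm_apply (h.clm_apply mdifferentiableAt_const) mdifferentiableAt_const,
        mvfderiv_clm_apply h mdifferentiableAt_const]
      simp [mvfderiv_const]
    rw [hderiv, hderiv, funext fun q ↦ hb q v w]
  · simp [mvfderiv, mfderiv_zero_of_not_mdifferentiableAt h]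

end Calculus

section PreferredChart

variable {F : Type*} [NormedAddCommGroup F] [NormedSpace ℝ F]
  {N : Type*} [TopologicalSpace N] [ChartedSpace F N]
  {V : Type*} [NormedAddCommGroup V] [NormedSpace ℝ V]

/-- The vector field `Z` read in the preferred chart at `p`, as a vector field on the model
space `F`. -/
def fieldInChart (p : N) (Z : ∀ q : N, TangentSpace 𝓘(ℝ, F) q) : F → F :=
  VectorField.mpullback 𝓘(ℝ, F) 𝓘(ℝ, F) (extChartAt 𝓘(ℝ, F) p).symm Z

variable {p : N}

lemma contDiffAt_comp_extChartAt_symm {n : ℕ∞ω} {h : N → V} (hh : CMDiffAt n h p) :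
    ContDiffAt ℝ n (h ∘ (extChartAt 𝓘(ℝ, F) p).symm) (extChartAt 𝓘(ℝ, F) p p) := by
  have hc := (contMDiffAt_iff.1 hh).2
  rwa [modelWithCornersSelf_coe, Set.range_id, contDiffWithinAt_univ] at hc

variable [IsManifold 𝓘(ℝ, F) 1 N]

lemma mvfderiv_eq_fderiv_comp_extChartAt_symm {h : N → V}
    (hh : DifferentiableAt ℝ (h ∘ (extChartAt 𝓘(ℝ, F) p).symm) (extChartAt 𝓘(ℝ, F) p p))
    (v : TangentSpace 𝓘(ℝ, F) p) :
    d% h p v = fderiv ℝ (h ∘ (extChartAt 𝓘(ℝ, F) p).symm) (extChartAt 𝓘(ℝ, F) p p) v := by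
  have heq : h =ᶠ[nhds p] (h ∘ (extChartAt 𝓘(ℝ, F) p).symm) ∘ extChartAt 𝓘(ℝ, F) p := by
    filter_upwards [extChartAt_source_mem_nhds (I := 𝓘(ℝ, F)) p] with q hq
    simp only [Function.comp_apply, (extChartAt 𝓘(ℝ, F) p).left_inv hq]
  have hchain : mfderiv 𝓘(ℝ, F) 𝓘(ℝ, V) h p =
      (fderiv ℝ (h ∘ (extChartAt 𝓘(ℝ, F) p).symm) (extChartAt 𝓘(ℝ, F) p p)).comp
        (mfderiv 𝓘(ℝ, F) 𝓘(ℝ, F) (extChartAt 𝓘(ℝ, F) p) p) := by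
    rw [heq.mfderiv_eq, mfderiv_comp p hh.mdifferentiableAt
      (mdifferentiableAt_extChartAt (mem_chart_source F p)), mfderiv_eq_fderiv]
    rfl
  rw [mfderiv_extChartAt_self] at hchain
  exact congrArg (fun L : F →L[ℝ] V ↦ L v) hchain

lemma isInvertible_mfderiv_extChartAt_symm {y : F} (hy : y ∈ (extChartAt 𝓘(ℝ, F) p).target) :
    (mfderiv 𝓘(ℝ, F) 𝓘(ℝ, F) (extChartAt 𝓘(ℝ, F) p).symm y).IsInvertible := by
  have h := isInvertible_mfderivWithin_extChartAt_symm (I := 𝓘(ℝ, F)) hy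
  rwa [modelWithCornersSelf_coe, Set.range_id, mfderivWithin_univ] at h

lemma mdifferentiableAt_extChartAt_symm {y : F} (hy : y ∈ (extChartAt 𝓘(ℝ, F) p).target) :
    MDiffAt (extChartAt 𝓘(ℝ, F) p).symm y := by
  have h := mdifferentiableWithinAt_extChartAt_symm (I := 𝓘(ℝ, F)) hy
  rwa [modelWithCornersSelf_coe, Set.range_id, mdifferentiableWithinAt_univ] at h

lemma fieldInChart_self (p : N) (Z : ∀ q : N, TangentSpace 𝓘(ℝ, F) q) :
    fieldInChart p Z (extChartAt 𝓘(ℝ, F) p p) = Z p := by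
  have h := mfderivWithin_extChartAt_symm_inverse_apply (I := 𝓘(ℝ, F)) (x := p)
    (Z ((extChartAt 𝓘(ℝ, F) p).symm (extChartAt 𝓘(ℝ, F) p p)))
  rw [modelWithCornersSelf_coe, Set.range_id, mfderivWithin_univ] at h
  exact h.trans (by rw [extChartAt_to_inv])

lemma fderiv_comp_extChartAt_symm_fieldInChart {h : N → V} {y : F}
    (hy : y ∈ (extChartAt 𝓘(ℝ, F) p).target) (hh : MDiffAt h ((extChartAt 𝓘(ℝ, F) p).symm y))
    (Z : ∀ q : N, TangentSpace 𝓘(ℝ, F) q) :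
    fderiv ℝ (h ∘ (extChartAt 𝓘(ℝ, F) p).symm) y (fieldInChart p Z y) =
      d% h ((extChartAt 𝓘(ℝ, F) p).symm y) (Z ((extChartAt 𝓘(ℝ, F) p).symm y)) := by
  have hZ : mfderiv 𝓘(ℝ, F) 𝓘(ℝ, F) (extChartAt 𝓘(ℝ, F) p).symm y (fieldInChart (F := F) p Z y) =
      Z ((extChartAt 𝓘(ℝ, F) p).symm y) :=
    (isInvertible_mfderiv_extChartAt_symm hy).self_apply_inverse _
  rw [← hZ, ← mfderiv_eq_fderiv, mfderiv_comp y hh (mdifferentiableAt_extChartAt_symm hy)]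
  rfl

lemma mlieBracket_eq_lieBracket_fieldInChart (X Y : ∀ q : N, TangentSpace 𝓘(ℝ, F) q) :
    VectorField.mlieBracket 𝓘(ℝ, F) X Y p =
      VectorField.lieBracket ℝ (fieldInChart p X) (fieldInChart p Y) (extChartAt 𝓘(ℝ, F) p p) := by
  have h := VectorField.mlieBracketWithin_apply (I := 𝓘(ℝ, F)) (V := X) (W := Y) (s := Set.univ)
    (x₀ := p)
  rw [VectorField.mlieBracketWithin_univ, mfderiv_extChartAt_self, Set.preimage_univ,
    Set.univ_inter, modelWithCornersSelf_coe, Set.range_id, VectorField.mpullbackWithin_univ,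
    VectorField.mpullbackWithin_univ] at h
  rw [← VectorField.lieBracketWithin_univ]
  exact h.trans (congrArg (fun L : F →L[ℝ] F ↦ L _) ContinuousLinearMap.inverse_id)

lemma eventuallyEq_mvfderiv_apply_comp_extChartAt_symm {h : N → V}
    (hh : ∀ᶠ q in nhds p, MDiffAt h q)
    (Z : ∀ q : N, TangentSpace 𝓘(ℝ, F) q) :
    (fun q ↦ d% h q (Z q)) ∘ (extChartAt 𝓘(ℝ, F) p).symm =ᶠ[nhds (extChartAt 𝓘(ℝ, F) p p)]
      fun y ↦ fderiv ℝ (h ∘ (extChartAt 𝓘(ℝ, F) p).symm) y (fieldInChart p Z y) := by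
  have hcont := continuousAt_extChartAt_symm (I := 𝓘(ℝ, F)) p
  rw [ContinuousAt, extChartAt_to_inv] at hcont
  filter_upwards [extChartAt_target_mem_nhds p, hcont.eventually hh] with y hy hhy
  exact (fderiv_comp_extChartAt_symm_fieldInChart hy hhy Z).symm

end PreferredChart

section LieBracket

variable {F : Type*} [NormedAddCommGroup F] [NormedSpace ℝ F] [CompleteSpace F]
  {N : Type*} [TopologicalSpace N] [ChartedSpace F N] [IsManifold 𝓘(ℝ, F) 2 N]
  {V : Type*} [NormedAddCommGroup V] [NormedSpace ℝ V]
  {p : N} {X Y Z : ∀ q : N, TangentSpace 𝓘(ℝ, F) q}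

lemma differentiableAt_fieldInChart (hZ : MDiffAt (T% Z) p) :
    DifferentiableAt ℝ (fieldInChart p Z) (extChartAt 𝓘(ℝ, F) p p) := by
  have h : DifferentiableWithinAt ℝ (VectorField.mpullbackWithin 𝓘(ℝ, F) 𝓘(ℝ, F)
      (extChartAt 𝓘(ℝ, F) p).symm Z (Set.range 𝓘(ℝ, F))) _ _ :=
    (mdifferentiableWithinAt_univ.2 hZ).differentiableWithinAt_mpullbackWithin_vectorField
  rw [Set.preimage_univ, Set.univ_inter, modelWithCornersSelf_coe, Set.range_id,
    VectorField.mpullbackWithin_univ] at h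
  exact differentiableWithinAt_univ.1 h

lemma mvfderiv_mvfderiv_apply_field {h : N → V} (hh : CMDiffAt 2 h p) (hZ : MDiffAt (T% Z) p)
    (v : TangentSpace 𝓘(ℝ, F) p) :
    d% (fun q ↦ d% h q (Z q)) p v =
      fderiv ℝ (fun y ↦ fderiv ℝ (h ∘ (extChartAt 𝓘(ℝ, F) p).symm) y (fieldInChart p Z y))
        (extChartAt 𝓘(ℝ, F) p p) v := by
  have hnear : ∀ᶠ q in nhds p, MDiffAt h q :=
    ((contMDiffAt_iff_contMDiffAt_nhds (by simp)).1 hh).mono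
      fun q hq ↦ hq.mdifferentiableAt (by simp)
  have heq := eventuallyEq_mvfderiv_apply_comp_extChartAt_symm hnear Z
  have hdiff : DifferentiableAt ℝ
      (fun y ↦ fderiv ℝ (h ∘ (extChartAt 𝓘(ℝ, F) p).symm) y (fieldInChart p Z y))
      (extChartAt 𝓘(ℝ, F) p p) :=
    (((contDiffAt_comp_extChartAt_symm hh).fderiv_right (m := 1) (by norm_num)).differentiableAt
      (by simp)).clm_apply (differentiableAt_fieldInChart hZ)
  rw [mvfderiv_eq_fderiv_comp_extChartAt_symm (heq.differentiableAt_iff.2 hdiff), heq.fderiv_eq]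

lemma mvfderiv_mlieBracket {h : N → V} (hh : CMDiffAt 2 h p) (hX : MDiffAt (T% X) p)
    (hY : MDiffAt (T% Y) p) :
    d% h p (VectorField.mlieBracket 𝓘(ℝ, F) X Y p) =
      d% (fun q ↦ d% h q (Y q)) p (X p) - d% (fun q ↦ d% h q (X q)) p (Y p) := by
  have hc := contDiffAt_comp_extChartAt_symm hh
  have hbracket := VectorField.fderiv_apply_lieBracket hc (by simp)
    (differentiableAt_fieldInChart hY) (differentiableAt_fieldInChart hX)
  rw [fieldInChart_self, fieldInChart_self] at hbracket
  rw [mlieBracket_eq_lieBracket_fieldInChart, mvfderiv_mvfderiv_apply_field hh hX,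
    mvfderiv_mvfderiv_apply_field hh hY]
  exact (mvfderiv_eq_fderiv_comp_extChartAt_symm (hc.differentiableAt (by simp)) _).trans hbracket

end LieBracket

section VectorBundle

variable {𝕜 : Type*} [NontriviallyNormedField 𝕜]
  {B₁ : Type*} [TopologicalSpace B₁] {F₁ : Type*} [NormedAddCommGroup F₁] [NormedSpace 𝕜 F₁]
  {E₁ : B₁ → Type*} [∀ x, AddCommGroup (E₁ x)] [∀ x, Module 𝕜 (E₁ x)]
  [∀ x, TopologicalSpace (E₁ x)] [TopologicalSpace (TotalSpace F₁ E₁)] [FiberBundle F₁ E₁]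
  [VectorBundle 𝕜 F₁ E₁]
  {B₂ : Type*} [TopologicalSpace B₂] {F₂ : Type*} [NormedAddCommGroup F₂] [NormedSpace 𝕜 F₂]
  {E₂ : B₂ → Type*} [∀ x, AddCommGroup (E₂ x)] [∀ x, Module 𝕜 (E₂ x)]
  [∀ x, TopologicalSpace (E₂ x)] [TopologicalSpace (TotalSpace F₂ E₂)] [FiberBundle F₂ E₂]
  [VectorBundle 𝕜 F₂ E₂]

lemma inCoordinates_trivializationAt_snd {x₀ x : B₁} {y₀ y : B₂}
    (hx : x ∈ (trivializationAt F₁ E₁ x₀).baseSet) (hy : y ∈ (trivializationAt F₂ E₂ y₀).baseSet)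
    (φ : E₁ x →L[𝕜] E₂ y) (v : E₁ x) :
    ContinuousLinearMap.inCoordinates F₁ E₁ F₂ E₂ x₀ x y₀ y φ
      (trivializationAt F₁ E₁ x₀ ⟨x, v⟩).2 = (trivializationAt F₂ E₂ y₀ ⟨y, φ v⟩).2 := by
  simp [ContinuousLinearMap.inCoordinates, hx, hy]

end VectorBundle

section TangentBundle

variable {E : Type*} [NormedAddCommGroup E] [NormedSpace ℝ E]
  {M : Type*} [TopologicalSpace M] [ChartedSpace E M] [IsManifold 𝓘(ℝ, E) 1 M]
  {F : Type*} [NormedAddCommGroup F] [NormedSpace ℝ F]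

lemma trivializationAt_apply_snd {x y : M} (hy : y ∈ (chartAt E x).source)
    (v : TangentSpace 𝓘(ℝ, E) y) :
    (trivializationAt E (TangentSpace 𝓘(ℝ, E)) x ⟨y, v⟩).2 =
      mfderiv 𝓘(ℝ, E) 𝓘(ℝ, E) (extChartAt 𝓘(ℝ, E) x) y v := by
  refine Eq.trans ?_
    (congrArg (· v) (TangentBundle.continuousLinearMapAt_trivializationAt (𝕜 := ℝ) hy))
  rw [Trivialization.continuousLinearMapAt_apply,
    Trivialization.coe_linearMapAt_of_mem _ (by simpa using hy)]

lemma trivializationAt_self_snd (x : M) (v : TangentSpace 𝓘(ℝ, E) x) :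
    (trivializationAt E (TangentSpace 𝓘(ℝ, E)) x ⟨x, v⟩).2 = v := by
  rw [trivializationAt_apply_snd (mem_chart_source E x), mfderiv_extChartAt_self]
  rfl

lemma inCoordinates_self {M' : Type*} [TopologicalSpace M'] [ChartedSpace F M']
    [IsManifold 𝓘(ℝ, F) 1 M'] {x : M} {y : M'}
    (A : TangentSpace 𝓘(ℝ, E) x →L[ℝ] TangentSpace 𝓘(ℝ, F) y) :
    ContinuousLinearMap.inCoordinates E (TangentSpace 𝓘(ℝ, E)) F (TangentSpace 𝓘(ℝ, F))
      x x y y A = A := by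
  ext v
  have h := inCoordinates_trivializationAt_snd
    (FiberBundle.mem_baseSet_trivializationAt' (F := E) (E := TangentSpace 𝓘(ℝ, E)) x)
    (FiberBundle.mem_baseSet_trivializationAt' (F := F) (E := TangentSpace 𝓘(ℝ, F)) y) A v
  rw [trivializationAt_self_snd y] at h
  exact (congrArg _ (trivializationAt_self_snd (E := E) x v).symm).trans h

variable {N : Type*} {f : N → M} {p q : N}

/-- The vector field `V` along the map `f : N → M`, read in the trivialization of `TM` given by the
preferred chart at `f p`. -/
def alongInChart (f : N → M) (V : ∀ q : N, TangentSpace 𝓘(ℝ, E) (f q)) (p q : N) : E :=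
  (trivializationAt E (TangentSpace 𝓘(ℝ, E)) (f p) ⟨f q, V q⟩).2

lemma alongInChart_self (V : ∀ q : N, TangentSpace 𝓘(ℝ, E) (f q)) : alongInChart f V p p = V p :=
  trivializationAt_self_snd (f p) (V p)

/-- The field of endomorphisms `A` near `x`, read in the trivialization of `TM` given by the
preferred chart at `x`. -/
def endInChart (A : ∀ x : M, TangentSpace 𝓘(ℝ, E) x →L[ℝ] TangentSpace 𝓘(ℝ, E) x) (x y : M) :
    E →L[ℝ] E :=
  ContinuousLinearMap.inCoordinates E (TangentSpace 𝓘(ℝ, E)) E (TangentSpace 𝓘(ℝ, E)) x y x y (A y)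

lemma endInChart_apply_alongInChart
    (A : ∀ x : M, TangentSpace 𝓘(ℝ, E) x →L[ℝ] TangentSpace 𝓘(ℝ, E) x)
    (V : ∀ q : N, TangentSpace 𝓘(ℝ, E) (f q)) (hq : f q ∈ (chartAt E (f p)).source) :
    endInChart A (f p) (f q) (alongInChart f V p q) =
      alongInChart f (fun q ↦ A (f q) (V q)) p q :=
  have hq' : f q ∈ (trivializationAt E (TangentSpace 𝓘(ℝ, E)) (f p)).baseSet := by simpa using hq
  inCoordinates_trivializationAt_snd hq' hq' (A (f q)) (V q)

variable [TopologicalSpace N] [ChartedSpace F N]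

lemma mvfderiv_alongInChart_clm_apply (hf : MDiffAt f p)
    {A : ∀ x : M, TangentSpace 𝓘(ℝ, E) x →L[ℝ] TangentSpace 𝓘(ℝ, E) x}
    (hA : MDiffAt (endInChart A (f p)) (f p)) {V : ∀ q : N, TangentSpace 𝓘(ℝ, E) (f q)}
    (hV : MDiffAt (alongInChart f V p) p) (u : TangentSpace 𝓘(ℝ, F) p) :
    d% (alongInChart f (fun q ↦ A (f q) (V q)) p) p u = HAdd.hAdd (α := E) (β := E)
      (d% (endInChart A (f p)) (f p) (mfderiv 𝓘(ℝ, F) 𝓘(ℝ, E) f p u) (V p))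
      (A (f p) (d% (alongInChart f V p) p u)) := by
  have hAV : alongInChart f (fun q ↦ A (f q) (V q)) p =ᶠ[nhds p]
      fun q ↦ endInChart A (f p) (f q) (alongInChart f V p q) :=
    (hf.continuousAt.eventually (chart_source_mem_nhds E (f p))).mono fun q hq ↦
      (endInChart_apply_alongInChart A V hq).symm
  have hAf : d% (endInChart A (f p) ∘ f) p u =
      d% (endInChart A (f p)) (f p) (mfderiv 𝓘(ℝ, F) 𝓘(ℝ, E) f p u) :=
    congrArg (fun L : F →L[ℝ] E →L[ℝ] E ↦ L u) (mfderiv_comp p hA hf)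
  rw [mvfderiv_congr hAV]
  refine (mvfderiv_clm_apply (hA.comp p hf) hV u).trans ?_
  rw [hAf, alongInChart_self, Function.comp_apply, endInChart, inCoordinates_self]
  rfl

lemma mvfderiv_extChartAt_comp (hf : MDiffAt f q) (hq : f q ∈ (chartAt E (f p)).source)
    (u : TangentSpace 𝓘(ℝ, F) q) :
    d% (extChartAt 𝓘(ℝ, E) (f p) ∘ f) q u =
      mfderiv 𝓘(ℝ, E) 𝓘(ℝ, E) (extChartAt 𝓘(ℝ, E) (f p)) (f q)
        (mfderiv 𝓘(ℝ, F) 𝓘(ℝ, E) f q u) := by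
  rw [mvfderiv, mfderiv_comp q (mdifferentiableAt_extChartAt hq) hf]
  rfl

lemma mvfderiv_extChartAt_comp_self (hf : MDiffAt f p) (u : TangentSpace 𝓘(ℝ, F) p) :
    d% (extChartAt 𝓘(ℝ, E) (f p) ∘ f) p u = mfderiv 𝓘(ℝ, F) 𝓘(ℝ, E) f p u := by
  rw [mvfderiv_extChartAt_comp hf (mem_chart_source E (f p)), mfderiv_extChartAt_self]
  rfl

lemma alongInChart_mfderiv (hf : MDiffAt f q) (hq : f q ∈ (chartAt E (f p)).source)
    (Y : ∀ q : N, TangentSpace 𝓘(ℝ, F) q) :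
    alongInChart f (fun q ↦ mfderiv 𝓘(ℝ, F) 𝓘(ℝ, E) f q (Y q)) p q =
      d% (extChartAt 𝓘(ℝ, E) (f p) ∘ f) q (Y q) := by
  rw [alongInChart, trivializationAt_apply_snd hq, mvfderiv_extChartAt_comp hf hq]

end TangentBundle

section LeviCivita

namespace SemiRiemannianMetric

variable {E : Type*} [NormedAddCommGroup E] [NormedSpace ℝ E]
  {M : Type*} [TopologicalSpace M] [ChartedSpace E M] [IsManifold 𝓘(ℝ, E) ∞ M]
  (g : SemiRiemannianMetric E M)

lemma inChart_symm (x y : M) (v w : E) : g.inChart x y v w = g.inChart x y w v :=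
  g.symm y _ _

lemma christoffel_symm (x : M) (v w : TangentSpace 𝓘(ℝ, E) x) :
    g.christoffel x v w = g.christoffel x w v := by
  let dG : E →L[ℝ] E →L[ℝ] E →L[ℝ] ℝ := d% (g.inChart x) x
  have hdG (z v w : E) : dG z v w = dG z w v :=
    mvfderiv_apply_comm (g.inChart_symm x) x z v w
  have hlower (v w : E) : ((1 / 2 : ℝ) • (dG v + dG.flip v - (dG.flip v).flip)) w =
      ((1 / 2 : ℝ) • (dG w + dG.flip w - (dG.flip w).flip)) v := by
    ext z
    change (1 / 2 : ℝ) * (dG v w z + dG w v z - dG z v w) =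
      (1 / 2 : ℝ) * (dG w v z + dG v w z - dG z w v)
    rw [hdG z v w, add_comm (dG v w z)]
  exact congrArg (fun L ↦ (g.val x).inverse L) (hlower v w)

variable {F : Type*} [NormedAddCommGroup F] [NormedSpace ℝ F]
  {N : Type*} [TopologicalSpace N] [ChartedSpace F N] {f : N → M} {p : N}
  {V W : ∀ q : N, TangentSpace 𝓘(ℝ, E) (f q)}

lemma covDerivAlong_eq (u : TangentSpace 𝓘(ℝ, F) p) :
    g.covDerivAlong f V p u = HAdd.hAdd (α := E) (β := E)
      (d% (alongInChart f V p) p u)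
      (g.christoffel (f p) (mfderiv 𝓘(ℝ, F) 𝓘(ℝ, E) f p u) (V p)) :=
  rfl

lemma covDerivAlong_clm_apply (hf : MDiffAt f p)
    {A : ∀ x : M, TangentSpace 𝓘(ℝ, E) x →L[ℝ] TangentSpace 𝓘(ℝ, E) x}
    (hA : MDiffAt (endInChart A (f p)) (f p)) (hV : MDiffAt (alongInChart f V p) p)
    (u : TangentSpace 𝓘(ℝ, F) p) :
    g.covDerivAlong f (fun q ↦ A (f q) (V q)) p u =
      g.covDerivEnd A (f p) (mfderiv 𝓘(ℝ, F) 𝓘(ℝ, E) f p u) (V p) +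
        A (f p) (g.covDerivAlong f V p u) := by
  rw [g.covDerivAlong_eq, mvfderiv_alongInChart_clm_apply hf hA hV]
  let a : E →L[ℝ] E := A (f p)
  let Γ : E →L[ℝ] E := g.christoffel (f p) (mfderiv 𝓘(ℝ, F) 𝓘(ℝ, E) f p u)
  let dA : E →L[ℝ] E := d% (endInChart A (f p)) (f p) (mfderiv 𝓘(ℝ, F) 𝓘(ℝ, E) f p u)
  let dV : E := d% (alongInChart f V p) p u
  let v : E := V p
  change dA v + a dV + Γ (a v) = dA v + Γ (a v) - a (Γ v) + a (dV + Γ v)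
  rw [map_add]
  abel

variable (V) in
lemma isLinearMap_covDerivAlong : IsLinearMap ℝ (g.covDerivAlong (F := F) f V p) := by
  let d : F →L[ℝ] E := d% (alongInChart f V p) p
  let Γ : E →L[ℝ] E := g.christoffel (f p) (V p)
  let df : F →L[ℝ] E := mfderiv 𝓘(ℝ, F) 𝓘(ℝ, E) f p
  have h : g.covDerivAlong f V p = ⇑(d + Γ ∘L df) := by
    ext u
    rw [g.covDerivAlong_eq, g.christoffel_symm]
    rfl
  exact h ▸ (d + Γ ∘L df).toLinearMap.isLinear

lemma covDerivAlong_congr (h : ∀ᶠ q in nhds p, V q = W q) (u : TangentSpace 𝓘(ℝ, F) p) :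
    g.covDerivAlong f V p u = g.covDerivAlong f W p u := by
  have hVW : alongInChart f V p =ᶠ[nhds p] alongInChart f W p :=
    h.mono fun q hq ↦ by rw [alongInChart, alongInChart, hq]
  rw [g.covDerivAlong_eq, g.covDerivAlong_eq, mvfderiv_congr hVW, h.self_of_nhds]

lemma mvfderiv_alongInChart_mfderiv [IsManifold 𝓘(ℝ, F) 1 N] (hf : CMDiffAt 1 f p)
    (Z : ∀ q : N, TangentSpace 𝓘(ℝ, F) q) :
    d% (alongInChart f (fun q ↦ mfderiv 𝓘(ℝ, F) 𝓘(ℝ, E) f q (Z q)) p) p =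
      d% (fun q ↦ d% (extChartAt 𝓘(ℝ, E) (f p) ∘ f) q (Z q)) p := by
  refine mvfderiv_congr ?_
  filter_upwards [hf.continuousAt.eventually (chart_source_mem_nhds E (f p)),
    (contMDiffAt_iff_contMDiffAt_nhds (by simp)).1 hf] with q hq hfq
  exact alongInChart_mfderiv (hfq.mdifferentiableAt (by simp)) hq Z

lemma covDerivAlong_mfderiv_sub [CompleteSpace F] [IsManifold 𝓘(ℝ, F) 2 N] (hf : CMDiffAt 2 f p)
    {X Y : ∀ q : N, TangentSpace 𝓘(ℝ, F) q} (hX : MDiffAt (T% X) p) (hY : MDiffAt (T% Y) p) :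
    g.covDerivAlong f (fun q ↦ mfderiv 𝓘(ℝ, F) 𝓘(ℝ, E) f q (Y q)) p (X p) -
      g.covDerivAlong f (fun q ↦ mfderiv 𝓘(ℝ, F) 𝓘(ℝ, E) f q (X q)) p (Y p) =
      mfderiv 𝓘(ℝ, F) 𝓘(ℝ, E) f p (VectorField.mlieBracket 𝓘(ℝ, F) X Y p) := by
  have hf' : CMDiffAt 1 f p := hf.of_le (by norm_num)
  have hbracket := mvfderiv_mlieBracket
    (h := extChartAt 𝓘(ℝ, E) (f p) ∘ f) (contMDiffAt_extChartAt.comp p hf) hX hY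
  rw [mvfderiv_extChartAt_comp_self (hf.mdifferentiableAt (by simp)),
    ← mvfderiv_alongInChart_mfderiv hf' X, ← mvfderiv_alongInChart_mfderiv hf' Y] at hbracket
  rw [g.covDerivAlong_eq, g.covDerivAlong_eq,
    g.christoffel_symm (f p) _ (mfderiv 𝓘(ℝ, F) 𝓘(ℝ, E) f p (Y p))]
  exact (add_sub_add_right_eq_sub (G := E) _ _ _).trans hbracket.symm

end SemiRiemannianMetric

end LeviCivita

section Smoothness

lemma hasLeftInverse_of_injective {𝕜 : Type*} [NontriviallyNormedField 𝕜] [IsRCLikeNormedField 𝕜]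
    {F : Type*} [NormedAddCommGroup F] [NormedSpace 𝕜 F] [FiniteDimensional 𝕜 F]
    {E : Type*} [NormedAddCommGroup E] [NormedSpace 𝕜 E]
    {A : F →L[𝕜] E} (hA : Function.Injective A) : A.HasLeftInverse := by
  have : CompleteSpace 𝕜 := (IsRCLikeNormedField.rclike 𝕜).toCompleteSpace
  let e := LinearEquiv.ofInjective A.toLinearMap hA
  obtain ⟨L, hL⟩ :=
    e.symm.toLinearMap.toContinuousLinearMap.exist_extension_of_finiteDimensional_range
  exact ⟨L, fun v ↦ (DFunLike.congr_fun hL (e v)).symm.trans (e.symm_apply_apply v)⟩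

lemma contMDiffAt_of_clm_apply {𝕜 : Type*} [NontriviallyNormedField 𝕜]
    {B : Type*} [NormedAddCommGroup B] [NormedSpace 𝕜 B] {H : Type*} [TopologicalSpace H]
    {I : ModelWithCorners 𝕜 B H} {N : Type*} [TopologicalSpace N] [ChartedSpace H N]
    {F : Type*} [NormedAddCommGroup F] [NormedSpace 𝕜 F] [CompleteSpace F]
    {E : Type*} [NormedAddCommGroup E] [NormedSpace 𝕜 E] {n : WithTop ℕ∞}
    {A : N → F →L[𝕜] E} {w : N → F} {p : N} (hA : CMDiffAt n A p) (hAp : (A p).HasLeftInverse)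
    (hw : CMDiffAt n (fun q ↦ A q (w q)) p) : CMDiffAt n w p := by
  obtain ⟨L, hL⟩ := hAp
  have hid : L ∘L A p = ContinuousLinearEquiv.refl 𝕜 F := ContinuousLinearMap.ext hL
  have hLA : CMDiffAt n (fun q ↦ L ∘L A q) p := contMDiffAt_const.clm_comp hA
  have hinverse : CMDiffAt n (fun q ↦ (L ∘L A q).inverse) p := by
    have h : ContDiffAt 𝕜 n ContinuousLinearMap.inverse (L ∘L A p) :=
      hid ▸ contDiffAt_map_inverse (ContinuousLinearEquiv.refl 𝕜 F)
    exact h.contMDiffAt.comp p hLA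
  have hinvertible : ∀ᶠ q in nhds p, (L ∘L A q).IsInvertible := by
    have h := (ContinuousLinearEquiv.refl 𝕜 F).nhds
    rw [← hid] at h
    exact hLA.continuousAt.eventually h
  have hLw : CMDiffAt n (fun q ↦ L (A q (w q))) p := contMDiffAt_const.clm_apply hw
  exact (hinverse.clm_apply hLw).congr_of_eventuallyEq
    (hinvertible.mono fun q hq ↦ (hq.inverse_apply_self _).symm)

variable {E : Type*} [NormedAddCommGroup E] [NormedSpace ℝ E]
  {M : Type*} [TopologicalSpace M] [ChartedSpace E M] [IsManifold 𝓘(ℝ, E) ∞ M]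
  {A : ∀ x : M, TangentSpace 𝓘(ℝ, E) x →L[ℝ] TangentSpace 𝓘(ℝ, E) x}
  {F : Type*} [NormedAddCommGroup F] [NormedSpace ℝ F]
  {N : Type*} [TopologicalSpace N] [ChartedSpace F N] {f : N → M} {p q : N}
  {V : ∀ q : N, TangentSpace 𝓘(ℝ, E) (f q)} {Y : ∀ q : N, TangentSpace 𝓘(ℝ, F) q}

lemma contMDiffAt_alongInChart
    (hV : CMDiffAt ∞ (fun q ↦ (⟨f q, V q⟩ : TangentBundle 𝓘(ℝ, E) M)) p) :
    CMDiffAt ∞ (alongInChart f V p) p :=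
  (contMDiffAt_totalSpace.1 hV).2

lemma IsSmoothEndOn.mdifferentiableAt_endInChart {x : M} {U : Set M} (hA : IsSmoothEndOn A U)
    (hU : U ∈ nhds x) : MDiffAt (endInChart A x) x :=
  ((contMDiffAt_hom_bundle _).1 (hA.contMDiffAt hU)).2.mdifferentiableAt (by simp)

lemma IsSmoothEndOn.contMDiffAt_apply {U : Set M} (hA : IsSmoothEndOn A U) (hU : U ∈ nhds (f p))
    (hf : CMDiffAt ∞ f p)
    (hV : CMDiffAt ∞ (fun q ↦ (⟨f q, V q⟩ : TangentBundle 𝓘(ℝ, E) M)) p) :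
    CMDiffAt ∞ (fun q ↦ (⟨f q, A (f q) (V q)⟩ : TangentBundle 𝓘(ℝ, E) M)) p :=
  ContMDiffAt.clm_bundle_apply ((hA.contMDiffAt hU).comp p hf) hV

variable [IsManifold 𝓘(ℝ, F) ∞ N]

lemma contMDiffAt_mfderiv_field (hf : CMDiff ∞ f) (hY : CMDiffAt ∞ (T% Y) p) :
    CMDiffAt ∞
      (fun q ↦ (⟨f q, mfderiv 𝓘(ℝ, F) 𝓘(ℝ, E) f q (Y q)⟩ : TangentBundle 𝓘(ℝ, E) M)) p :=
  (hf.contMDiff_tangentMap (m := ∞) (by norm_cast)).contMDiffAt.comp p hY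

lemma inTangentCoordinates_mfderiv_apply (hq : q ∈ (chartAt F p).source)
    (hfq : f q ∈ (chartAt E (f p)).source) (u : TangentSpace 𝓘(ℝ, F) q) :
    inTangentCoordinates 𝓘(ℝ, F) 𝓘(ℝ, E) id f (mfderiv 𝓘(ℝ, F) 𝓘(ℝ, E) f) p q
      (trivializationAt F (TangentSpace 𝓘(ℝ, F)) p ⟨q, u⟩).2 =
      (trivializationAt E (TangentSpace 𝓘(ℝ, E)) (f p)
        ⟨f q, mfderiv 𝓘(ℝ, F) 𝓘(ℝ, E) f q u⟩).2 :=
  inCoordinates_trivializationAt_snd (by simpa using hq) (by simpa using hfq) _ u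

lemma contMDiffAt_of_mfderiv_field [CompleteSpace F] (hf : CMDiffAt ∞ f p)
    (hfp : (mfderiv 𝓘(ℝ, F) 𝓘(ℝ, E) f p).HasLeftInverse)
    (hY : CMDiffAt ∞
      (fun q ↦ (⟨f q, mfderiv 𝓘(ℝ, F) 𝓘(ℝ, E) f q (Y q)⟩ : TangentBundle 𝓘(ℝ, E) M)) p) :
    CMDiffAt ∞ (T% Y) p := by
  let df : N → F →L[ℝ] E :=
    inTangentCoordinates 𝓘(ℝ, F) 𝓘(ℝ, E) id f (mfderiv 𝓘(ℝ, F) 𝓘(ℝ, E) f) p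
  have hdf : CMDiffAt ∞ df p := hf.mfderiv_const (by norm_cast)
  have hdfp : df p = mfderiv 𝓘(ℝ, F) 𝓘(ℝ, E) f p := inCoordinates_self _
  refine (contMDiffAt_section p).2 (contMDiffAt_of_clm_apply hdf (hdfp ▸ hfp) ?_)
  refine (contMDiffAt_alongInChart hY).congr_of_eventuallyEq ?_
  filter_upwards [chart_source_mem_nhds F p,
    hf.continuousAt.eventually (chart_source_mem_nhds E (f p))] with q hq hfq
  exact inTangentCoordinates_mfderiv_apply hq hfq (Y q)

end Smoothness

section BilinearForm

variable {𝕜 : Type*} [NontriviallyNormedField 𝕜]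
  {F : Type*} [NormedAddCommGroup F] [NormedSpace 𝕜 F] [FiniteDimensional 𝕜 F]
  {b : F →L[𝕜] F →L[𝕜] 𝕜}

lemma mem_of_orthogonal_orthogonal (hs : ∀ u v, b u v = b v u)
    (hb : ∀ u, (∀ v, b u v = 0) → u = 0) {W : Submodule 𝕜 F} {u : F}
    (hu : ∀ z, (∀ v ∈ W, b z v = 0) → b u z = 0) : u ∈ W := by
  let B : LinearMap.BilinForm 𝕜 F := b.toLinearMap₁₂
  have hrefl : B.IsRefl := fun v w h ↦ (hs w v).trans h
  have hnondeg : B.Nondegenerate := ⟨hb, fun v h ↦ hb v fun w ↦ (hs v w).trans (h w)⟩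
  rw [← LinearMap.BilinForm.orthogonal_orthogonal hnondeg hrefl W]
  refine LinearMap.BilinForm.mem_orthogonal_iff.2 fun z hz ↦ (hs z u).trans (hu z fun v hv ↦ ?_)
  exact (hs z v).trans (LinearMap.BilinForm.mem_orthogonal_iff.1 hz v hv)

variable [CompleteSpace 𝕜]

lemma isInvertible_of_nondegenerate (hb : ∀ u, (∀ v, b u v = 0) → u = 0) : b.IsInvertible := by
  have hinj : Function.Injective b :=
    (injective_iff_map_eq_zero b).2 fun u hu ↦ hb u fun v ↦ by rw [hu, zero_apply]
  have hrank : Module.finrank 𝕜 F = Module.finrank 𝕜 (F →L[𝕜] 𝕜) :=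
    Subspace.dual_finrank_eq.symm.trans LinearMap.toContinuousLinearMap.finrank_eq
  exact ⟨(LinearEquiv.ofInjectiveOfFinrankEq b.toLinearMap hinj hrank).toContinuousLinearEquiv, rfl⟩

end BilinearForm

section SecondFundamentalForm

variable {E : Type*} [NormedAddCommGroup E] [NormedSpace ℝ E]
  {M : Type*} [TopologicalSpace M] [ChartedSpace E M] [IsManifold 𝓘(ℝ, E) ∞ M]
  {F : Type*} [NormedAddCommGroup F] [NormedSpace ℝ F]
  {N : Type*} [TopologicalSpace N] [ChartedSpace F N]

namespace SemiRiemannianMetric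

variable (g : SemiRiemannianMetric E M) {f : N → M} {p : N}
  {X X' Y Y' : ∀ q : N, TangentSpace 𝓘(ℝ, F) q}

variable (f p) in
lemma isLinearMap_normalPart : IsLinearMap ℝ (g.normalPart F f p) where
  map_add v w := by
    simp only [normalPart, tangentPart, map_add, ContinuousLinearMap.add_comp]
    abel
  map_smul c v := by
    simp only [normalPart, tangentPart, map_smul, ContinuousLinearMap.smul_comp, smul_sub]

lemma secondFundamentalForm_congr_left (h : X p = X' p) :
    g.secondFundamentalForm f X Y p = g.secondFundamentalForm f X' Y p := by
  rw [secondFundamentalForm, secondFundamentalForm, h]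

lemma secondFundamentalForm_congr_right (h : ∀ᶠ q in nhds p, Y q = Y' q) :
    g.secondFundamentalForm f X Y p = g.secondFundamentalForm f X Y' p := by
  rw [secondFundamentalForm, secondFundamentalForm,
    g.covDerivAlong_congr (h.mono fun q hq ↦ congrArg _ hq)]

variable (X Y) in
lemma secondFundamentalForm_neg_left :
    g.secondFundamentalForm f (-X) Y p = -g.secondFundamentalForm f X Y p := by
  rw [secondFundamentalForm, secondFundamentalForm, Pi.neg_apply,
    (g.isLinearMap_covDerivAlong _).map_neg, (g.isLinearMap_normalPart f p).map_neg]

end SemiRiemannianMetric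

namespace IsNondegenerateSubmanifold

variable {g : SemiRiemannianMetric E M} {f : N → M} {p : N}
  {X Y : ∀ q : N, TangentSpace 𝓘(ℝ, F) q} (hf : IsNondegenerateSubmanifold F g f)
include hf

lemma mfderiv_injective (p : N) : Function.Injective (mfderiv 𝓘(ℝ, F) 𝓘(ℝ, E) f p) := by
  refine (injective_iff_map_eq_zero _).2 fun u hu ↦ hf.nondegenerate p u fun v ↦ ?_
  change g.val (f p) (mfderiv 𝓘(ℝ, F) 𝓘(ℝ, E) f p u) (mfderiv 𝓘(ℝ, F) 𝓘(ℝ, E) f p v) = 0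
  rw [hu, map_zero]
  rfl

variable [FiniteDimensional ℝ F]

lemma tangentPart_mfderiv (u : TangentSpace 𝓘(ℝ, F) p) :
    g.tangentPart f p (mfderiv 𝓘(ℝ, F) 𝓘(ℝ, E) f p u) = u :=
  (isInvertible_of_nondegenerate (F := F) (hf.nondegenerate p)).inverse_apply_self u

lemma normalPart_eq_zero_iff {w : TangentSpace 𝓘(ℝ, E) (f p)} :
    g.normalPart F f p w = 0 ↔ w ∈ Set.range (mfderiv 𝓘(ℝ, F) 𝓘(ℝ, E) f p) := by
  refine ⟨fun h ↦ ⟨_, (sub_eq_zero.1 h).symm⟩, ?_⟩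
  rintro ⟨u, rfl⟩
  rw [SemiRiemannianMetric.normalPart, hf.tangentPart_mfderiv, sub_self]

variable [IsManifold 𝓘(ℝ, F) 2 N]

lemma covDerivAlong_mfderiv_sub (hX : MDiffAt (T% X) p) (hY : MDiffAt (T% Y) p) :
    g.covDerivAlong f (fun q ↦ mfderiv 𝓘(ℝ, F) 𝓘(ℝ, E) f q (Y q)) p (X p) -
      g.covDerivAlong f (fun q ↦ mfderiv 𝓘(ℝ, F) 𝓘(ℝ, E) f q (X q)) p (Y p) =
      mfderiv 𝓘(ℝ, F) 𝓘(ℝ, E) f p (VectorField.mlieBracket 𝓘(ℝ, F) X Y p) :=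
  have := FiniteDimensional.complete ℝ F
  g.covDerivAlong_mfderiv_sub ((hf.isImmersion.contMDiff p).of_le (by norm_cast)) hX hY

lemma secondFundamentalForm_comm (hX : MDiffAt (T% X) p) (hY : MDiffAt (T% Y) p) :
    g.secondFundamentalForm f X Y p = g.secondFundamentalForm f Y X p := by
  rw [← sub_eq_zero, SemiRiemannianMetric.secondFundamentalForm,
    SemiRiemannianMetric.secondFundamentalForm, ← (g.isLinearMap_normalPart f p).map_sub,
    hf.covDerivAlong_mfderiv_sub hX hY]
  exact hf.normalPart_eq_zero_iff.2 (Set.mem_range_self _)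

end IsNondegenerateSubmanifold

end SecondFundamentalForm

section ParaquaternionicStructure

variable {E : Type*} [NormedAddCommGroup E] [NormedSpace ℝ E]
  {M : Type*} [TopologicalSpace M] [ChartedSpace E M] [IsManifold 𝓘(ℝ, E) ∞ M]

/-- The field of endomorphisms `A` is a smooth section over the open set `V` of the bundle `σ` of an
almost paraquaternionic structure. -/
structure AlmostParaquaternionicStructure.IsLocalSection
    (σ : AlmostParaquaternionicStructure E M) (V : Set M)
    (A : ∀ x : M, TangentSpace 𝓘(ℝ, E) x →L[ℝ] TangentSpace 𝓘(ℝ, E) x) : Prop where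
  isOpen : IsOpen V
  smooth : IsSmoothEndOn A V
  mem : ∀ x ∈ V, A x ∈ σ.fiber x

variable {σ : AlmostParaquaternionicStructure E M} {V : Set M}

lemma AlmostParaquaternionicStructure.exists_isCanonicalLocalBasis_mapsTo
    (σ : AlmostParaquaternionicStructure E M) {N : Type*} [TopologicalSpace N] {f : N → M}
    (hf : Continuous f) {U : Set N} (hU : IsOpen U) {p : N} (hp : p ∈ U) :
    ∃ U' ⊆ U, IsOpen U' ∧ p ∈ U' ∧
      ∃ V J, IsCanonicalLocalBasis σ.fiber V J ∧ Set.MapsTo f U' V := by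
  obtain ⟨V, hpV, J, hJ⟩ := σ.exists_basis (f p)
  exact ⟨U ∩ f ⁻¹' V, Set.inter_subset_left, hU.inter (hJ.isOpen.preimage hf), ⟨hp, hpV⟩, V, J, hJ,
    fun q hq ↦ hq.2⟩

namespace IsCanonicalLocalBasis

variable {J : Fin 3 → ∀ x : M, TangentSpace 𝓘(ℝ, E) x →L[ℝ] TangentSpace 𝓘(ℝ, E) x} {x : M}

lemma isLocalSection (hJ : IsCanonicalLocalBasis σ.fiber V J) (a : Fin 3) :
    σ.IsLocalSection V (J a) :=
  ⟨hJ.isOpen, hJ.smooth a, fun x hx ↦ hJ.span_eq x hx ▸ Submodule.subset_span ⟨a, rfl⟩⟩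

variable {τ : ∀ x : M, Submodule ℝ (TangentSpace 𝓘(ℝ, E) x →L[ℝ] TangentSpace 𝓘(ℝ, E) x)}
  (hJ : IsCanonicalLocalBasis τ V J) (hx : x ∈ V) (v : TangentSpace 𝓘(ℝ, E) x)
include hJ hx

lemma zero_zero_apply : J 0 x (J 0 x v) = -v := by
  have h := hJ.sq x hx 0
  rw [show epsilon 0 = 1 from rfl, neg_one_smul] at h
  exact congr($h v)

lemma one_two_apply : J 1 x (J 2 x v) = J 0 x v := by
  have h := hJ.mul x hx 1
  rw [show (1 + 2 : Fin 3) = 0 from rfl, show epsilon 0 = 1 from rfl, one_smul] at h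
  exact congr($h v)

lemma two_one_apply : J 2 x (J 1 x v) = -J 0 x v := by
  rw [← hJ.one_two_apply hx, eq_neg_iff_add_eq_zero, add_comm, ← eq_neg_iff_add_eq_zero]
  exact congr($(hJ.anticomm x hx 1) v)

end IsCanonicalLocalBasis

end ParaquaternionicStructure

section CRSubmanifold

variable {E : Type*} [NormedAddCommGroup E] [NormedSpace ℝ E]
  {M : Type*} [TopologicalSpace M] [ChartedSpace E M] [IsManifold 𝓘(ℝ, E) ∞ M]
  {F : Type*} [NormedAddCommGroup F] [NormedSpace ℝ F]
  {N : Type*} [TopologicalSpace N] [ChartedSpace F N]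

/-- The field `A` of endomorphisms of `TM` acting on vector fields of the submanifold `f : N → M`:
the tangent part of `A (df X)`. On the paraquaternionic distribution of a CR-submanifold it
represents `A X`, which is then tangent to `N`. -/
def SemiRiemannianMetric.tangentialAction (g : SemiRiemannianMetric E M) (f : N → M)
    (A : ∀ x : M, TangentSpace 𝓘(ℝ, E) x →L[ℝ] TangentSpace 𝓘(ℝ, E) x)
    (X : ∀ q : N, TangentSpace 𝓘(ℝ, F) q) (q : N) : TangentSpace 𝓘(ℝ, F) q :=
  g.tangentPart f q (A (f q) (mfderiv 𝓘(ℝ, F) 𝓘(ℝ, E) f q (X q)))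

variable [IsManifold 𝓘(ℝ, F) ∞ N]

namespace IsSectionOn

variable {D : ∀ q : N, Submodule ℝ (TangentSpace 𝓘(ℝ, F) q)}
  {X : ∀ q : N, TangentSpace 𝓘(ℝ, F) q} {U U' : Set N} (hX : IsSectionOn D X U)
include hX

lemma mono (h : U' ⊆ U) : IsSectionOn D X U' :=
  ⟨ContMDiffOn.mono hX.1 h, fun q hq ↦ hX.2 q (h hq)⟩

lemma contMDiffAt {p : N} (hU : U ∈ nhds p) : CMDiffAt ∞ (T% X) p :=
  ContMDiffOn.contMDiffAt hX.1 hU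

lemma mdifferentiableAt {p : N} (hU : U ∈ nhds p) : MDiffAt (T% X) p :=
  (hX.contMDiffAt hU).mdifferentiableAt (by simp)

end IsSectionOn

namespace IsParaquaternionicCRSubmanifold

variable {g : SemiRiemannianMetric E M} {σ : AlmostParaquaternionicStructure E M} {f : N → M}
  {D : ∀ q : N, Submodule ℝ (TangentSpace 𝓘(ℝ, F) q)} {p q : N}
  (hN : IsParaquaternionicCRSubmanifold g σ f D)
include hN

lemma contMDiff : CMDiff ∞ f :=
  hN.submanifold.isImmersion.contMDiff

lemma exists_mfderiv_eq_apply {L : TangentSpace 𝓘(ℝ, E) (f q) →L[ℝ] TangentSpace 𝓘(ℝ, E) (f q)}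
    (hL : L ∈ σ.fiber (f q)) {u : TangentSpace 𝓘(ℝ, F) q} (hu : u ∈ D q) :
    ∃ w ∈ D q, mfderiv 𝓘(ℝ, F) 𝓘(ℝ, E) f q w = L (mfderiv 𝓘(ℝ, F) 𝓘(ℝ, E) f q u) := by
  let df := (mfderiv 𝓘(ℝ, F) 𝓘(ℝ, E) f q).toLinearMap
  obtain ⟨V, hqV, J, hJ⟩ := σ.exists_basis (f q)
  have hle : σ.fiber (f q) ≤
      ((D q).map df).comap ((ContinuousLinearMap.coeLM ℝ).flip (df u)) := by
    rw [← hJ.span_eq (f q) hqV, Submodule.span_le]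
    rintro _ ⟨a, rfl⟩
    exact (hN.invariant V J hJ q hqV a).le
      (Submodule.mem_map_of_mem (Submodule.mem_map_of_mem hu))
  exact hle hL

variable [FiniteDimensional ℝ F]
  {A : ∀ x : M, TangentSpace 𝓘(ℝ, E) x →L[ℝ] TangentSpace 𝓘(ℝ, E) x}
  {X Y : ∀ q : N, TangentSpace 𝓘(ℝ, F) q}

lemma mfderiv_tangentialAction (hA : A (f q) ∈ σ.fiber (f q)) (hX : X q ∈ D q) :
    mfderiv 𝓘(ℝ, F) 𝓘(ℝ, E) f q (g.tangentialAction f A X q) =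
      A (f q) (mfderiv 𝓘(ℝ, F) 𝓘(ℝ, E) f q (X q)) := by
  obtain ⟨w, -, hw⟩ := hN.exists_mfderiv_eq_apply hA hX
  rw [SemiRiemannianMetric.tangentialAction, ← hw, hN.submanifold.tangentPart_mfderiv]

lemma tangentialAction_mem (hA : A (f q) ∈ σ.fiber (f q)) (hX : X q ∈ D q) :
    g.tangentialAction f A X q ∈ D q := by
  obtain ⟨w, hwD, hw⟩ := hN.exists_mfderiv_eq_apply hA hX
  rwa [SemiRiemannianMetric.tangentialAction, ← hw, hN.submanifold.tangentPart_mfderiv]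

variable {V : Set M} {J : Fin 3 → ∀ x : M, TangentSpace 𝓘(ℝ, E) x →L[ℝ] TangentSpace 𝓘(ℝ, E) x}
  (hJ : IsCanonicalLocalBasis σ.fiber V J)

section PointwiseRelations

variable (hq : f q ∈ V) (hX : X q ∈ D q)
include hJ hq hX

lemma tangentialAction_zero_zero :
    g.tangentialAction f (J 0) (g.tangentialAction f (J 0) X) q = -X q := by
  have hJ₀ := (hJ.isLocalSection 0).mem _ hq
  apply hN.submanifold.mfderiv_injective q
  rw [hN.mfderiv_tangentialAction hJ₀ (hN.tangentialAction_mem hJ₀ hX),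
    hN.mfderiv_tangentialAction hJ₀ hX, hJ.zero_zero_apply hq, map_neg]

lemma tangentialAction_one_two :
    g.tangentialAction f (J 1) (g.tangentialAction f (J 2) X) q =
      g.tangentialAction f (J 0) X q := by
  have hmem (a : Fin 3) : J a (f q) ∈ σ.fiber (f q) := (hJ.isLocalSection a).mem _ hq
  apply hN.submanifold.mfderiv_injective q
  rw [hN.mfderiv_tangentialAction (hmem 1) (hN.tangentialAction_mem (hmem 2) hX),
    hN.mfderiv_tangentialAction (hmem 2) hX, hN.mfderiv_tangentialAction (hmem 0) hX,
    hJ.one_two_apply hq]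

lemma tangentialAction_two_one :
    g.tangentialAction f (J 2) (g.tangentialAction f (J 1) X) q =
      -g.tangentialAction f (J 0) X q := by
  have hmem (a : Fin 3) : J a (f q) ∈ σ.fiber (f q) := (hJ.isLocalSection a).mem _ hq
  apply hN.submanifold.mfderiv_injective q
  rw [map_neg, hN.mfderiv_tangentialAction (hmem 2) (hN.tangentialAction_mem (hmem 1) hX),
    hN.mfderiv_tangentialAction (hmem 1) hX, hN.mfderiv_tangentialAction (hmem 0) hX,
    hJ.two_one_apply hq]

end PointwiseRelations

variable {U : Set N} (hU : IsOpen U) (hUV : Set.MapsTo f U V)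
include hU hUV

lemma isSectionOn_tangentialAction (hA : σ.IsLocalSection V A) (hX : IsSectionOn D X U) :
    IsSectionOn D (g.tangentialAction f A X) U := by
  have := FiniteDimensional.complete ℝ F
  refine ⟨fun q hq ↦ ContMDiffAt.contMDiffWithinAt ?_,
    fun q hq ↦ hN.tangentialAction_mem (hA.mem _ (hUV hq)) (hX.2 q hq)⟩
  refine contMDiffAt_of_mfderiv_field (hN.contMDiff q)
    (hasLeftInverse_of_injective (F := F) (E := E) (hN.submanifold.mfderiv_injective q)) ?_
  refine (hA.smooth.contMDiffAt_apply (hA.isOpen.mem_nhds (hUV hq)) (hN.contMDiff q)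
    (contMDiffAt_mfderiv_field hN.contMDiff
      (hX.contMDiffAt (hU.mem_nhds hq)))).congr_of_eventuallyEq ?_
  filter_upwards [hU.mem_nhds hq] with r hr
  rw [hN.mfderiv_tangentialAction (hA.mem _ (hUV hr)) (hX.2 r hr)]

lemma secondFundamentalForm_tangentialAction_right (hσ : IsParallel g σ)
    (hA : σ.IsLocalSection V A) (hY : IsSectionOn D Y U) (hp : p ∈ U) :
    g.secondFundamentalForm f X (g.tangentialAction f A Y) p = g.normalPart F f p (A (f p)
      (g.covDerivAlong f (fun q ↦ mfderiv 𝓘(ℝ, F) 𝓘(ℝ, E) f q (Y q)) p (X p))) := by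
  have hAY : ∀ᶠ q in nhds p, mfderiv 𝓘(ℝ, F) 𝓘(ℝ, E) f q (g.tangentialAction f A Y q) =
      A (f q) (mfderiv 𝓘(ℝ, F) 𝓘(ℝ, E) f q (Y q)) :=
    Filter.mem_of_superset (hU.mem_nhds hp) fun q hq ↦
      hN.mfderiv_tangentialAction (hA.mem _ (hUV hq)) (hY.2 q hq)
  have hdY : MDiffAt (alongInChart f (fun q ↦ mfderiv 𝓘(ℝ, F) 𝓘(ℝ, E) f q (Y q)) p) p :=
    (contMDiffAt_alongInChart (contMDiffAt_mfderiv_field hN.contMDiff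
      (hY.contMDiffAt (hU.mem_nhds hp)))).mdifferentiableAt (by simp)
  have hdA : g.covDerivEnd A (f p) (mfderiv 𝓘(ℝ, F) 𝓘(ℝ, E) f p (X p)) ∈ σ.fiber (f p) :=
    hσ V A hA.isOpen hA.smooth hA.mem (f p) (hUV hp) _
  obtain ⟨w, -, hw⟩ := hN.exists_mfderiv_eq_apply hdA (hY.2 p hp)
  rw [SemiRiemannianMetric.secondFundamentalForm, g.covDerivAlong_congr hAY,
    g.covDerivAlong_clm_apply ((hN.contMDiff p).mdifferentiableAt (by simp))
      (hA.smooth.mdifferentiableAt_endInChart (hA.isOpen.mem_nhds (hUV hp))) hdY,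
    (g.isLinearMap_normalPart f p).map_add,
    hN.submanifold.normalPart_eq_zero_iff.2 ⟨w, hw⟩, zero_add]

lemma secondFundamentalForm_tangentialAction_comm (hσ : IsParallel g σ) (hD : IsIntegrable D)
    (hA : σ.IsLocalSection V A) (hX : IsSectionOn D X U) (hY : IsSectionOn D Y U) (hp : p ∈ U) :
    g.secondFundamentalForm f X (g.tangentialAction f A Y) p =
      g.secondFundamentalForm f (g.tangentialAction f A X) Y p := by
  have hUp := hU.mem_nhds hp
  have hAX := hN.isSectionOn_tangentialAction hU hUV hA hX
  obtain ⟨w, -, hw⟩ :=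
    hN.exists_mfderiv_eq_apply (hA.mem _ (hUV hp)) (hD U X Y hU hX hY p hp)
  rw [hN.submanifold.secondFundamentalForm_comm (hAX.mdifferentiableAt hUp)
      (hY.mdifferentiableAt hUp),
    hN.secondFundamentalForm_tangentialAction_right hU hUV hσ hA hY hp,
    hN.secondFundamentalForm_tangentialAction_right hU hUV hσ hA hX hp,
    ← sub_eq_zero, ← (g.isLinearMap_normalPart f p).map_sub, ← map_sub,
    hN.submanifold.covDerivAlong_mfderiv_sub (hX.mdifferentiableAt hUp)
      (hY.mdifferentiableAt hUp)]
  exact hN.submanifold.normalPart_eq_zero_iff.2 ⟨w, hw⟩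

include hJ in
lemma secondFundamentalForm_tangentialAction_zero_left (hσ : IsParallel g σ) (hD : IsIntegrable D)
    (hX : IsSectionOn D X U) (hY : IsSectionOn D Y U)
    (hp : p ∈ U) : g.secondFundamentalForm f (g.tangentialAction f (J 0) X) Y p = 0 := by
  have hswap (a : Fin 3) {X Y : ∀ q : N, TangentSpace 𝓘(ℝ, F) q} (hX : IsSectionOn D X U)
      (hY : IsSectionOn D Y U) := hN.secondFundamentalForm_tangentialAction_comm hU hUV hσ hD
    (hJ.isLocalSection a) hX hY hp
  have hsection (a : Fin 3) {X : ∀ q : N, TangentSpace 𝓘(ℝ, F) q} (hX : IsSectionOn D X U) :=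
    hN.isSectionOn_tangentialAction hU hUV (hJ.isLocalSection a) hX
  have hJ₁₂ : ∀ᶠ q in nhds p, g.tangentialAction f (J 0) Y q =
      g.tangentialAction f (J 1) (g.tangentialAction f (J 2) Y) q :=
    Filter.mem_of_superset (hU.mem_nhds hp) fun q hq ↦
      (hN.tangentialAction_one_two hJ (hUV hq) (hY.2 q hq)).symm
  have hJ₂₁ : g.tangentialAction f (J 2) (g.tangentialAction f (J 1) X) p =
      (-g.tangentialAction f (J 0) X) p :=
    hN.tangentialAction_two_one hJ (hUV hp) (hX.2 p hp)
  have : IsAddTorsionFree E := .of_isTorsionFree ℝ E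
  refine (self_eq_neg (G := E)).1 ?_
  calc g.secondFundamentalForm f (g.tangentialAction f (J 0) X) Y p
    _ = g.secondFundamentalForm f X (g.tangentialAction f (J 0) Y) p := (hswap 0 hX hY).symm
    _ = g.secondFundamentalForm f X
          (g.tangentialAction f (J 1) (g.tangentialAction f (J 2) Y)) p :=
        g.secondFundamentalForm_congr_right hJ₁₂
    _ = g.secondFundamentalForm f (g.tangentialAction f (J 1) X) (g.tangentialAction f (J 2) Y) p :=
        hswap 1 hX (hsection 2 hY)
    _ = g.secondFundamentalForm f
          (g.tangentialAction f (J 2) (g.tangentialAction f (J 1) X)) Y p :=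
        hswap 2 (hsection 1 hX) hY
    _ = -g.secondFundamentalForm f (g.tangentialAction f (J 0) X) Y p := by
        rw [g.secondFundamentalForm_congr_left hJ₂₁, g.secondFundamentalForm_neg_left]

omit hU hUV

lemma isGeodesicFor_of_isIntegrable (hσ : IsParallel g σ) (hD : IsIntegrable D) :
    IsGeodesicFor g f D := by
  intro U₀ X Y hU₀ hX hY p hp₀
  obtain ⟨U, hUU₀, hU, hp, V, J, hJ, hUV⟩ :=
    σ.exists_isCanonicalLocalBasis_mapsTo hN.contMDiff.continuous hU₀ hp₀
  have hX := hX.mono hUU₀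
  have hJ₀X := hN.isSectionOn_tangentialAction hU hUV (hJ.isLocalSection 0) hX
  have hJ₀₀ : g.tangentialAction f (J 0) (g.tangentialAction f (J 0) X) p = (-X) p :=
    hN.tangentialAction_zero_zero hJ (hUV hp) (hX.2 p hp)
  rw [← neg_eq_zero, ← g.secondFundamentalForm_neg_left, ← g.secondFundamentalForm_congr_left hJ₀₀]
  exact hN.secondFundamentalForm_tangentialAction_zero_left hJ hU hUV hσ hD hJ₀X (hY.mono hUU₀) hp

include hJ hU hUV

lemma val_covDerivAlong_eq_zero (hM : IsParaquaternionicKahler g σ) (hY : IsSectionOn D Y U)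
    (hp : p ∈ U)
    (hXY : g.secondFundamentalForm f X (g.tangentialAction f (J 0) Y) p = 0)
    {z : TangentSpace 𝓘(ℝ, F) p} (hz : ∀ v ∈ D p, g.induced f p z v = 0) :
    g.val (f p) (g.covDerivAlong f (fun q ↦ mfderiv 𝓘(ℝ, F) 𝓘(ℝ, E) f q (Y q)) p (X p))
      (mfderiv 𝓘(ℝ, F) 𝓘(ℝ, E) f p z) = 0 := by
  rw [hN.secondFundamentalForm_tangentialAction_right hU hUV hM.parallel (hJ.isLocalSection 0) hY
    hp] at hXY
  obtain ⟨w, hw⟩ := hN.submanifold.normalPart_eq_zero_iff.1 hXY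
  have hJ₀ := hM.adapted V J hJ (f p) (hUV hp) 0
    (g.covDerivAlong f (fun q ↦ mfderiv 𝓘(ℝ, F) 𝓘(ℝ, E) f q (Y q)) p (X p))
    (mfderiv 𝓘(ℝ, F) 𝓘(ℝ, E) f p z)
  rw [show epsilon 0 = 1 from rfl, one_mul] at hJ₀
  rw [← hJ₀, ← hw, g.symm]
  exact hN.totallyReal V J hJ p (hUV hp) 0 z hz w

omit hJ hU hUV

lemma isIntegrable_of_isGeodesicFor (hM : IsParaquaternionicKahler g σ)
    (hD : IsGeodesicFor g f D) : IsIntegrable D := by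
  intro U₀ X Y hU₀ hX hY p hp₀
  obtain ⟨U, hUU₀, hU, hp, V, J, hJ, hUV⟩ :=
    σ.exists_isCanonicalLocalBasis_mapsTo hN.contMDiff.continuous hU₀ hp₀
  have hX := hX.mono hUU₀
  have hY := hY.mono hUU₀
  refine mem_of_orthogonal_orthogonal (F := F) (b := g.induced f p) (fun u v ↦ g.symm (f p) _ _)
    (hN.submanifold.nondegenerate p) fun z hz ↦ ?_
  have horth {X Y : ∀ q : N, TangentSpace 𝓘(ℝ, F) q} (hX : IsSectionOn D X U)
      (hY : IsSectionOn D Y U) := hN.val_covDerivAlong_eq_zero hJ hU hUV hM hY hp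
    (hD U X _ hU hX (hN.isSectionOn_tangentialAction hU hUV (hJ.isLocalSection 0) hY) p hp) hz
  change g.val (f p) (mfderiv 𝓘(ℝ, F) 𝓘(ℝ, E) f p _) (mfderiv 𝓘(ℝ, F) 𝓘(ℝ, E) f p z) = 0
  rw [← hN.submanifold.covDerivAlong_mfderiv_sub (hX.mdifferentiableAt (hU.mem_nhds hp))
    (hY.mdifferentiableAt (hU.mem_nhds hp)), map_sub, sub_apply, horth hX hY, horth hY hX, sub_zero]

end IsParaquaternionicCRSubmanifold

end CRSubmanifold

end ParaquaternionicGeometry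

end

/-- Invertibility of `g.val x` is what makes `christoffel` the Levi-Civita connection when `E` is
infinite-dimensional: otherwise `inverse` takes the junk value `0`. -/
theorem mainTheorem2_general
    {E : Type*} [NormedAddCommGroup E] [NormedSpace ℝ E]
    {M : Type*} [TopologicalSpace M] [ChartedSpace E M] [IsManifold 𝓘(ℝ, E) ∞ M]
    {F : Type*} [NormedAddCommGroup F] [NormedSpace ℝ F] [FiniteDimensional ℝ F]
    {N : Type*} [TopologicalSpace N] [ChartedSpace F N] [IsManifold 𝓘(ℝ, F) ∞ N]
    (g : ParaquaternionicGeometry.SemiRiemannianMetric E M)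
    (_hg : ∀ x, (g.val x).IsInvertible)
    (σ : ParaquaternionicGeometry.AlmostParaquaternionicStructure E M)
    (hM : ParaquaternionicGeometry.IsParaquaternionicKahler g σ)
    (f : N → M) (D : ∀ x : N, Submodule ℝ (TangentSpace 𝓘(ℝ, F) x))
    (hN : ParaquaternionicGeometry.IsParaquaternionicCRSubmanifold g σ f D) :
    ParaquaternionicGeometry.IsIntegrable D ↔
      ParaquaternionicGeometry.IsGeodesicFor g f D :=
  ⟨hN.isGeodesicFor_of_isIntegrable hM.parallel, hN.isIntegrable_of_isGeodesicFor hM⟩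

theorem mainTheorem2
    {E : Type*} [NormedAddCommGroup E] [NormedSpace ℝ E] [FiniteDimensional ℝ E]
    {M : Type*} [TopologicalSpace M] [ChartedSpace E M] [IsManifold 𝓘(ℝ, E) ∞ M]
    {F : Type*} [NormedAddCommGroup F] [NormedSpace ℝ F] [FiniteDimensional ℝ F]
    {N : Type*} [TopologicalSpace N] [ChartedSpace F N] [IsManifold 𝓘(ℝ, F) ∞ N]
    (g : ParaquaternionicGeometry.SemiRiemannianMetric E M)
    (σ : ParaquaternionicGeometry.AlmostParaquaternionicStructure E M)
    (hM : ParaquaternionicGeometry.IsParaquaternionicKahler g σ)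
    (f : N → M) (D : ∀ x : N, Submodule ℝ (TangentSpace 𝓘(ℝ, F) x))
    (hN : ParaquaternionicGeometry.IsParaquaternionicCRSubmanifold g σ f D) :
    ParaquaternionicGeometry.IsIntegrable D ↔
      ParaquaternionicGeometry.IsGeodesicFor g f D := by
  exact mainTheorem2_general g (fun x ↦ ParaquaternionicGeometry.isInvertible_of_nondegenerate
    (F := E) (g.nondegenerate x)) σ hM f D hN
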